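/- Let $(R,\mathfrak m)$ be a commutative noetherian local ring with $\mathfrak m$-adic completion $\widehat R$. Call an $\widehat R$-module algebraic if it is isomorphic, as an $\widehat R$-module, to the $\mathfrak m$-adic completion $\widehat N$ of some finitely generated $R$-module $N$. Let $\mathcal M$ be a finitely generated $\widehat R$-module of finite projective dimension such that $\operatorname{Ext}^i_{\widehat R}(\mathcal M,\widehat R)$ is an $\widehat R$-module of finite length for every $i>0$. Then $\mathcal M$ is strongly algebraic: every direct summand of $\mathcal M$ (in particular $\mathcal M$ itself) is algebraic. -/

import Mathlib

universe u v

/-- The completion of a local ring with respect to the topology of its maximal ideal. -/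
abbrev LocalCompletion (R : Type u) [CommRing R] [IsLocalRing R] : Type u :=
  AdicCompletion (IsLocalRing.maximalIdeal R) R

/-- A module over the completion of `R` is algebraic if it is isomorphic, over the completion of
`R`, to the completion of a finitely generated `R`-module. -/
def IsAlgebraicModule (R : Type u) [CommRing R] [IsLocalRing R]
    (M : Type v) [AddCommGroup M] [Module (LocalCompletion R) M] : Prop :=
  ∃ (N : Type u) (_ : AddCommGroup N) (_ : Module R N), Module.Finite R N ∧
    Nonempty (AdicCompletion (IsLocalRing.maximalIdeal R) N ≃ₗ[LocalCompletion R] M)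

/-- A module over the completion of `R` is strongly algebraic if each of its direct summands
(itself included) is algebraic. -/
def IsStronglyAlgebraicModule (R : Type u) [CommRing R] [IsLocalRing R]
    (M : Type v) [AddCommGroup M] [Module (LocalCompletion R) M] : Prop :=
  ∀ P Q : Submodule (LocalCompletion R) M, IsCompl P Q → IsAlgebraicModule R P

/-- The module `M` has finite projective dimension over `S`. The zero module is included. -/
def HasFiniteProjectiveDimension (S : Type u) [CommRing S]
    (M : Type u) [AddCommGroup M] [Module S M] : Prop :=
  ∃ n : ℕ, CategoryTheory.HasProjectiveDimensionLE (ModuleCat.of S M) n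

/-- The `i`-th Ext module of `M` with values in the ring `S`. -/
abbrev ExtIntoRing (S : Type u) [CommRing S]
    (M : Type u) [AddCommGroup M] [Module S M] (i : ℕ) : Type u :=
  CategoryTheory.Abelian.Ext (ModuleCat.of S M) (ModuleCat.of S S) i

/-!
Let `𝔪` be the maximal ideal of `S`, the completion of `R`. Write `M` as the cokernel of the
inclusion `φ : K → F` of a syzygy in a free module of finite rank. The syzygy `K` inherits the
hypotheses, so by induction on the projective dimension it comes from `R`. If `𝔪 ^ c` kills
`Ext¹(M, S)`, then every map in `𝔪 ^ c Hom(K, F)` factors through `φ`. As `R` is dense in `S`, the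
map `φ` agrees modulo `𝔪 ^ (c + 1) Hom(K, F)` with a map `φ'` defined over `R`. Hence
`φ - φ' = A ∘ φ` with `A ∈ 𝔪 End(F)`, so `φ' = (1 - A) ∘ φ`, where `1 - A` is invertible by
Nakayama's lemma. Thus `M` is also the cokernel of `φ'`, which comes from `R`.
-/

open CategoryTheory Abelian IsLocalRing Module TensorProduct

section Density

/-- The image of `R` in `S` is dense for the `I`-adic topology of `S`. -/
def IsAdicallyDense (R : Type*) {S : Type*} [CommRing R] [CommRing S] [Algebra R S]
    (I : Ideal S) : Prop :=
  ∀ (s : S) (k : ℕ), ∃ r : R, s - algebraMap R S r ∈ I ^ k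

theorem isAdicallyDense_adicCompletion {R : Type*} [CommRing R] {I : Ideal R} (hI : I.FG) :
    IsAdicallyDense R (I.map (algebraMap R (AdicCompletion I R))) := by
  intro s k
  obtain ⟨r, hr⟩ := Submodule.Quotient.mk_surjective _ (AdicCompletion.eval I R k s)
  have hker : s - algebraMap R (AdicCompletion I R) r ∈ (AdicCompletion.eval I R k).ker := by
    rw [LinearMap.mem_ker, map_sub, sub_eq_zero, ← hr]
    rfl
  rw [← AdicCompletion.pow_smul_top_eq_ker_eval hI] at hker
  exact ⟨r, by rwa [← Ideal.map_pow, ← Submodule.restrictScalars_mem R, ← Ideal.smul_top_eq_map]⟩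

theorem isAdicallyDense_maximalIdeal_localCompletion (R : Type*) [CommRing R] [IsLocalRing R]
    [IsNoetherianRing R] : IsAdicallyDense R (maximalIdeal (LocalCompletion R)) := by
  rw [AdicCompletion.maximalIdeal_eq_map]
  exact isAdicallyDense_adicCompletion (maximalIdeal R).fg_of_isNoetherianRing

end Density

section Noetherian

variable {R S : Type*} [CommRing R] [CommRing S] [Algebra R S]

theorem exists_mvPowerSeries_ringHom_X_eq {σ : Type*} [Finite σ] (I : Ideal S) [IsAdicComplete I S]
    {x : σ → S} (hx : ∀ i, x i ∈ I) :
    ∃ f : MvPowerSeries σ R →+* S,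
      f.comp MvPowerSeries.C = algebraMap R S ∧ ∀ i, f (MvPowerSeries.X i) = x i := by
  let _ : WithIdeal S := ⟨I⟩
  obtain ⟨_, _⟩ := (IsAdic.isAdicComplete_iff (I := I) rfl).1 ‹IsAdicComplete I S›
  let _ : UniformSpace R := ⊥
  have : DiscreteTopology R := ⟨rfl⟩
  have : IsUniformAddGroup R := inferInstance
  have heval : MvPowerSeries.HasEval x := by
    refine ⟨fun i ↦ I.hasBasis_nhds_zero_adic.tendsto_right_iff.2 fun k _ ↦ ?_, by simp⟩
    filter_upwards [Filter.eventually_ge_atTop k] with l hl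
    exact Ideal.pow_le_pow_right hl (Ideal.pow_mem_pow (hx i) l)
  refine ⟨MvPowerSeries.eval₂Hom (φ := algebraMap R S) continuous_of_discreteTopology heval,
    RingHom.ext fun r ↦ ?_, fun i ↦ ?_⟩ <;>
  simp [MvPowerSeries.coe_eval₂Hom]

theorem isNoetherianRing_of_isAdicComplete [IsNoetherianRing R] {I : Ideal S}
    [IsAdicComplete I S] (hI : I.FG) (hRI : Function.Surjective (algebraMap R (S ⧸ I))) :
    IsNoetherianRing S := by
  obtain ⟨n, x, hx⟩ := Submodule.fg_iff_exists_fin_generating_family.1 hI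
  obtain ⟨f, hfC, hfX⟩ := exists_mvPowerSeries_ringHom_X_eq (R := R) I
    fun i ↦ hx ▸ Submodule.subset_span (Set.mem_range_self i)
  let J : Ideal (MvPowerSeries (Fin n) R) := Ideal.span (Set.range MvPowerSeries.X)
  have hJ : J.map f = I := by
    rw [Ideal.map_span, ← Set.range_comp, (funext hfX : f ∘ MvPowerSeries.X = x)]
    exact hx
  have : IsHausdorff (J.map f) S := hJ ▸ inferInstance
  have hf : Function.Surjective f := by
    refine surjective_of_mk_map_comp_surjective (I := J) f ?_
    rw [hJ]
    intro y
    obtain ⟨r, rfl⟩ := hRI y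
    exact ⟨MvPowerSeries.C r, congrArg (Ideal.Quotient.mk I) (RingHom.congr_fun hfC r)⟩
  exact isNoetherianRing_of_surjective _ _ f hf

instance isNoetherianRing_adicCompletion [IsNoetherianRing R] (I : Ideal R) :
    IsNoetherianRing (AdicCompletion I R) := by
  have hI : I.FG := I.fg_of_isNoetherianRing
  let J : Ideal (AdicCompletion I R) := I.map (algebraMap R (AdicCompletion I R))
  have : IsAdicComplete J (AdicCompletion I R) := AdicCompletion.isAdicComplete_self I hI
  refine isNoetherianRing_of_isAdicComplete (R := R) (I := J) (hI.map _) fun y ↦ ?_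
  obtain ⟨s, rfl⟩ := Ideal.Quotient.mk_surjective y
  obtain ⟨r, hr⟩ := isAdicallyDense_adicCompletion hI s 1
  rw [pow_one] at hr
  exact ⟨r, (Ideal.Quotient.eq.2 hr).symm⟩

end Noetherian

section Perturbation

variable {S K F : Type*} [CommRing S] [AddCommGroup K] [Module S K] [AddCommGroup F] [Module S F]

theorem bijective_id_sub_of_mem_smul_top [Module.Finite S F] {J : Ideal S}
    (hJ : J ≤ Ideal.jacobson ⊥) {A : F →ₗ[S] F} (hA : A ∈ J • (⊤ : Submodule S (F →ₗ[S] F))) :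
    Function.Bijective (LinearMap.id - A : F →ₗ[S] F) := by
  have hAx (x : F) : A x ∈ J • (⊤ : Submodule S F) := by
    have hmap := Submodule.mem_map_of_mem (f := LinearMap.applyₗ x) hA
    rw [Submodule.map_smul''] at hmap
    exact Submodule.smul_mono le_rfl le_top hmap
  have hsurj : Function.Surjective (LinearMap.id - A : F →ₗ[S] F) := by
    rw [← LinearMap.range_eq_top, eq_top_iff]
    refine Submodule.le_of_le_smul_of_le_jacobson_bot Module.Finite.fg_top hJ fun x _ ↦ ?_
    rw [← sub_add_cancel x (A x)]
    exact Submodule.add_mem_sup (LinearMap.mem_range_self (LinearMap.id - A : F →ₗ[S] F) x) (hAx x)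
  exact ⟨OrzechProperty.injective_of_surjective_endomorphism _ hsurj, hsurj⟩

theorem exists_linearEquiv_comp_eq_of_sub_mem [Module.Finite S F] {I J : Ideal S}
    (hJ : J ≤ Ideal.jacobson ⊥) {φ φ' : K →ₗ[S] F}
    (hI : I • (⊤ : Submodule S (K →ₗ[S] F)) ≤ (φ.lcomp S F).range)
    (hφ : φ - φ' ∈ (J * I) • (⊤ : Submodule S (K →ₗ[S] F))) :
    ∃ e : F ≃ₗ[S] F, e.toLinearMap ∘ₗ φ = φ' := by
  have hmem : φ - φ' ∈ (J • (⊤ : Submodule S (F →ₗ[S] F))).map (φ.lcomp S F) := by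
    rw [Submodule.map_smul'', Submodule.map_top]
    rw [mul_smul] at hφ
    exact Submodule.smul_mono le_rfl hI hφ
  obtain ⟨A, hA, hAφ⟩ := hmem
  refine ⟨LinearEquiv.ofBijective _ (bijective_id_sub_of_mem_smul_top hJ hA), ?_⟩
  calc (LinearMap.id - A) ∘ₗ φ = φ - φ.lcomp S F A := rfl
    _ = φ' := by rw [hAφ, sub_sub_cancel]

theorem smul_top_le_range_lcomp_pi {I : Ideal S} {φ : K →ₗ[S] F} (ι : Type*) {G : Type*}
    [AddCommGroup G] [Module S G]
    (hI : I • (⊤ : Submodule S (K →ₗ[S] G)) ≤ (φ.lcomp S G).range) :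
    I • (⊤ : Submodule S (K →ₗ[S] (ι → G))) ≤ (φ.lcomp S (ι → G)).range := by
  refine Submodule.smul_le.2 fun a ha f _ ↦ ?_
  choose g hg using fun i ↦
    hI (Submodule.smul_mem_smul ha (Submodule.mem_top (x := LinearMap.proj i ∘ₗ f)))
  exact ⟨LinearMap.pi g, LinearMap.ext fun x ↦ funext fun i ↦ LinearMap.congr_fun (hg i) x⟩

end Perturbation

/-- An `S`-module is extended from `R` if it is isomorphic to the base change of a finitely
presented `R`-module. For `S` the completion of a noetherian local ring, these are the algebraic
modules. -/
def IsExtendedModule (R : Type v) (S : Type*) [CommRing R] [CommRing S] [Algebra R S] (M : Type*)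
    [AddCommGroup M] [Module S M] : Prop :=
  ∃ (N : Type v) (_ : AddCommGroup N) (_ : Module R N), Module.FinitePresentation R N ∧
    Nonempty (S ⊗[R] N ≃ₗ[S] M)

section Descent

variable {R : Type v} {S : Type*} [CommRing R] [CommRing S] [Algebra R S] {I : Ideal S}

theorem IsAdicallyDense.exists_sub_mem_pow_smul_top (hI : IsAdicallyDense R I) {H T : Type*}
    [AddCommMonoid H] [Module R H] [AddCommGroup T] [Module R T] [Module S T] [IsScalarTower R S T]
    {f : H →ₗ[R] T} (hf : IsBaseChange S f) (t : T) (k : ℕ) :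
    ∃ h : H, t - f h ∈ I ^ k • (⊤ : Submodule S T) := by
  induction t using hf.inductionOn with
  | zero => exact ⟨0, by simp⟩
  | tmul h => exact ⟨h, by simp⟩
  | smul s t ih =>
    obtain ⟨h, ht⟩ := ih
    obtain ⟨r, hr⟩ := hI s k
    refine ⟨r • h, ?_⟩
    have hsum : s • t - f (r • h) = s • (t - f h) + (s - algebraMap R S r) • f h := by
      rw [map_smul, smul_sub, sub_smul, algebraMap_smul, sub_add_sub_cancel]
    rw [hsum]
    exact add_mem (Submodule.smul_mem _ _ ht) (Submodule.smul_mem_smul hr Submodule.mem_top)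
  | add t₁ t₂ ih₁ ih₂ =>
    obtain ⟨h₁, ht₁⟩ := ih₁
    obtain ⟨h₂, ht₂⟩ := ih₂
    exact ⟨h₁ + h₂, by rw [map_add, add_sub_add_comm]; exact add_mem ht₁ ht₂⟩

variable {K F M : Type*} [AddCommGroup K] [Module S K] [AddCommGroup F] [Module S F]
  [AddCommGroup M] [Module S M]

theorem IsAdicallyDense.exists_sub_baseChange_mem_pow_smul_top [Flat R S]
    (hI : IsAdicallyDense R I) {N P : Type*} [AddCommGroup N] [Module R N]
    [FinitePresentation R N] [AddCommGroup P] [Module R P] (eK : S ⊗[R] N ≃ₗ[S] K)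
    (eF : S ⊗[R] P ≃ₗ[S] F) (φ : K →ₗ[S] F) (k : ℕ) :
    ∃ ψ : N →ₗ[R] P, φ - eF.toLinearMap ∘ₗ ψ.baseChange S ∘ₗ eK.symm.toLinearMap ∈
      I ^ k • (⊤ : Submodule S (K →ₗ[S] F)) := by
  let c : (S ⊗[R] N →ₗ[S] S ⊗[R] P) ≃ₗ[S] K →ₗ[S] F := eK.arrowCongr eF
  have happrox := hI.exists_sub_mem_pow_smul_top (T := S ⊗[R] N →ₗ[S] S ⊗[R] P)
    (f := LinearMap.baseChangeHom R S N P)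
  obtain ⟨ψ, hψ⟩ := happrox (FinitePresentation.isBaseChange_map R N P S) (c.symm φ) k
  refine ⟨ψ, ?_⟩
  have hmap := Submodule.mem_map_of_mem (f := c.toLinearMap) hψ
  rw [Submodule.map_smul'', LinearEquiv.coe_coe, map_sub, c.apply_symm_apply] at hmap
  exact Submodule.smul_mono le_rfl le_top hmap

theorem IsExtendedModule.of_exact_baseChange {N : Type*} {P : Type v} [AddCommGroup N] [Module R N]
    [Module.Finite R N] [AddCommGroup P] [Module R P] [FinitePresentation R P] (ψ : N →ₗ[R] P)
    {p : S ⊗[R] P →ₗ[S] M} (hψp : Function.Exact (ψ.baseChange S) p)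
    (hp : Function.Surjective p) : IsExtendedModule R S M := by
  have hψq : Function.Exact (ψ.baseChange S) (ψ.range.mkQ.baseChange S) :=
    lTensor_exact S (LinearMap.exact_map_mkQ_range ψ) (Submodule.mkQ_surjective _)
  have hq : Function.Surjective (ψ.range.mkQ.baseChange S) :=
    LinearMap.lTensor_surjective S (Submodule.mkQ_surjective _)
  exact ⟨P ⧸ ψ.range, inferInstance, inferInstance,
    finitePresentation_of_surjective _ (Submodule.mkQ_surjective _) (by simp),
    ⟨(hψq.linearEquivOfSurjective hq).symm ≪≫ₗ hψp.linearEquivOfSurjective hp⟩⟩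

theorem IsExtendedModule.of_exact [Flat R S] (hI : IsAdicallyDense R I)
    (hIJ : I ≤ Ideal.jacobson ⊥) (hK : IsExtendedModule R S K) (hF : IsExtendedModule R S F)
    {φ : K →ₗ[S] F} {p : F →ₗ[S] M} (hφp : Function.Exact φ p) (hp : Function.Surjective p) {c : ℕ}
    (hc : I ^ c • (⊤ : Submodule S (K →ₗ[S] F)) ≤ (φ.lcomp S F).range) :
    IsExtendedModule R S M := by
  obtain ⟨N, _, _, _, ⟨eK⟩⟩ := hK
  obtain ⟨P, _, _, _, ⟨eF⟩⟩ := hF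
  have : Module.Finite S F := Module.Finite.equiv eF
  obtain ⟨ψ, hψ⟩ := hI.exists_sub_baseChange_mem_pow_smul_top eK eF φ (c + 1)
  rw [pow_succ'] at hψ
  obtain ⟨e, he⟩ := exists_linearEquiv_comp_eq_of_sub_mem hIJ hc hψ
  let p' : S ⊗[R] P →ₗ[S] M := p ∘ₗ (eF ≪≫ₗ e.symm).toLinearMap
  have hψp' : Function.Exact (ψ.baseChange S) p' := by
    refine hφp.of_ladder_linearEquiv_of_exact (e₁ := eK.symm) (e₂ := e ≪≫ₗ eF.symm)
      (e₃ := LinearEquiv.refl S M) (LinearMap.ext fun x ↦ ?_) (LinearMap.ext fun x ↦ ?_)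
    · simpa using congrArg eF.symm (LinearMap.congr_fun he x).symm
    · simp [p']
  exact .of_exact_baseChange ψ hψp' (hp.comp (eF ≪≫ₗ e.symm).surjective)

variable (R) in
theorem IsExtendedModule.of_projective [IsLocalRing S] [Module.Finite S M]
    [Module.Projective S M] : IsExtendedModule R S M := by
  have : Module.Free S M := Module.free_of_flat_of_isLocalRing
  exact ⟨Fin (finrank S M) → R, inferInstance, inferInstance, inferInstance,
    ⟨TensorProduct.piScalarRight R S S _ ≪≫ₗ (Module.finBasis S M).equivFun.symm⟩⟩

end Descent

theorem exists_maximalIdeal_pow_le_annihilator {S E : Type*} [CommRing S] [IsLocalRing S]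
    [AddCommGroup E] [Module S E] (hE : IsFiniteLength S E) :
    ∃ c : ℕ, maximalIdeal S ^ c ≤ annihilator S E := by
  induction hE with
  | of_subsingleton => exact ⟨0, by simp [annihilator_eq_top_iff, *]⟩
  | @of_simple_quotient E _ _ E' _ _ ih =>
    obtain ⟨c, hc⟩ := ih
    have hquot : annihilator S (E ⧸ E') = maximalIdeal S :=
      eq_maximalIdeal IsSimpleModule.annihilator_isMaximal
    refine ⟨c + 1, ?_⟩
    rw [pow_succ]
    refine Ideal.mul_le.2 fun a ha b hb ↦ mem_annihilator.2 fun x ↦ ?_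
    have hbx : b • x ∈ E' := by
      rw [← hquot] at hb
      simpa [← Submodule.Quotient.mk_smul] using mem_annihilator.1 hb (Submodule.Quotient.mk x)
    rw [mul_smul]
    exact congrArg Subtype.val (mem_annihilator.1 (hc ha) ⟨b • x, hbx⟩)

section Ext

variable {S : Type*} [CommRing S] {C : Type*} [Category C] [Abelian C] [HasExt C] [Linear S C]

theorem annihilator_ext_le_of_retract {X X' : C} (h : Retract X X') (Y : C) (i : ℕ) :
    annihilator S (Ext X' Y i) ≤ annihilator S (Ext X Y i) := by
  refine ((Ext.mk₀ h.r).precompOfLinear S Y (zero_add i)).annihilator_le_of_injective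
    ((injective_iff_map_eq_zero _).2 fun x hx ↦ ?_)
  have hx' : (Ext.mk₀ h.r).comp x (zero_add i) = 0 := hx
  rw [← x.mk₀_id_comp, ← h.retract, ← Ext.mk₀_comp_mk₀, Ext.comp_assoc_of_second_deg_zero, hx',
    Ext.comp_zero]

variable {X : ShortComplex C} (hX : X.ShortExact) (Y : C)
include hX

theorem annihilator_ext_succ_le [Projective X.X₂] {i : ℕ} (hi : 0 < i) :
    annihilator S (Ext X.X₃ Y (i + 1)) ≤ annihilator S (Ext X.X₁ Y i) := by
  refine (hX.extClass.precompOfLinear S Y (add_comm 1 i)).annihilator_le_of_injective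
    ((injective_iff_map_eq_zero _).2 fun x hx ↦ ?_)
  obtain ⟨y, rfl⟩ := Ext.contravariant_sequence_exact₁ hX Y x (add_comm 1 i) hx
  rw [y.eq_zero_of_hasProjectiveDimensionLT 1 hi, Ext.comp_zero]

variable {Y} in
theorem exists_comp_eq_smul {a : S} (ha : a ∈ annihilator S (Ext X.X₃ Y 1)) (f : X.X₁ ⟶ Y) :
    ∃ g : X.X₂ ⟶ Y, X.f ≫ g = a • f := by
  obtain ⟨x, hx⟩ := Ext.contravariant_sequence_exact₁ hX Y (Ext.mk₀ (a • f)) (n₁ := 1) rfl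
    (by rw [Ext.mk₀_smul, Ext.comp_smul, mem_annihilator.1 ha])
  obtain ⟨g, rfl⟩ := Ext.homEquiv₀.symm.surjective x
  exact ⟨g, Ext.homEquiv₀.symm.injective (by simpa using hx)⟩

end Ext

theorem annihilator_ext_one_smul_top_le_range_lcomp {S F M G : Type u} [CommRing S] [AddCommGroup F]
    [Module S F] [AddCommGroup M] [Module S M] [AddCommGroup G] [Module S G] {p : F →ₗ[S] M}
    (hp : Function.Surjective p) :
    annihilator S (Ext (ModuleCat.of S M) (ModuleCat.of S G) 1) •
      (⊤ : Submodule S (p.ker →ₗ[S] G)) ≤ (p.ker.subtype.lcomp S G).range := by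
  refine Submodule.smul_le.2 fun a ha f _ ↦ ?_
  obtain ⟨g, hg⟩ :=
    exists_comp_eq_smul (LinearMap.shortExact_shortComplexKer hp) ha (ModuleCat.ofHom f)
  exact ⟨g.hom, congrArg ModuleCat.Hom.hom hg⟩

theorem isExtendedModule_of_hasProjectiveDimensionLE {R : Type v} {S : Type u} [CommRing R]
    [CommRing S] [IsLocalRing S] [IsNoetherianRing S] [Algebra R S] [Flat R S]
    (hRS : IsAdicallyDense R (maximalIdeal S)) (M : Type u) [AddCommGroup M] [Module S M]
    [Module.Finite S M] (n : ℕ) (hn : HasProjectiveDimensionLE (ModuleCat.of S M) n)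
    (hExt : ∀ i : ℕ, 0 < i → ∃ c : ℕ, maximalIdeal S ^ c ≤ annihilator S (ExtIntoRing S M i)) :
    IsExtendedModule R S M := by
  induction n generalizing M with
  | zero =>
    rw [← projective_iff_hasProjectiveDimensionLE_zero, ← IsProjective.iff_projective] at hn
    exact IsExtendedModule.of_projective R
  | succ n ih =>
    obtain ⟨d, p, hp⟩ := Module.Finite.exists_fin' S M
    have hX := LinearMap.shortExact_shortComplexKer hp
    have hfree : Projective p.shortComplexKer.X₂ :=
      (IsProjective.iff_projective (R := S) (Fin d → S)).1 inferInstance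
    have hK : IsExtendedModule R S p.ker := by
      refine ih p.ker ((hX.hasProjectiveDimensionLT_X₃_iff n hfree).1 hn) fun i hi ↦ ?_
      obtain ⟨c, hc⟩ := hExt (i + 1) i.succ_pos
      exact ⟨c, hc.trans (annihilator_ext_succ_le hX _ hi)⟩
    obtain ⟨c, hc⟩ := hExt 1 one_pos
    have hfactor :=
      (Submodule.smul_mono_left hc).trans (annihilator_ext_one_smul_top_le_range_lcomp hp)
    exact hK.of_exact hRS (maximalIdeal_le_jacobson _) (IsExtendedModule.of_projective R)
      p.exact_subtype_ker_map hp (smul_top_le_range_lcomp_pi (Fin d) hfactor)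

/-- The inclusion of a direct summand, as a retract in the category of modules. -/
noncomputable def retractOfIsCompl {S : Type*} [CommRing S] {M : Type u} [AddCommGroup M]
    [Module S M] {P Q : Submodule S M} (hPQ : IsCompl P Q) :
    Retract (ModuleCat.of S P) (ModuleCat.of S M) where
  i := ModuleCat.ofHom P.subtype
  r := ModuleCat.ofHom (P.projectionOnto Q hPQ)
  retract := by
    ext x
    exact congrArg Subtype.val (Submodule.projectionOnto_apply_left hPQ x)

theorem theorem3p7_general {R : Type v} {S : Type u} [CommRing R] [CommRing S] [IsLocalRing S]
    [IsNoetherianRing S] [Algebra R S] [Flat R S] (hRS : IsAdicallyDense R (maximalIdeal S))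
    {M : Type u} [AddCommGroup M] [Module S M] [Module.Finite S M]
    (hpd : HasFiniteProjectiveDimension S M)
    (hExt : ∀ i : ℕ, 0 < i → IsFiniteLength S (ExtIntoRing S M i))
    {P Q : Submodule S M} (hPQ : IsCompl P Q) : IsExtendedModule R S P := by
  obtain ⟨n, hn⟩ := hpd
  refine isExtendedModule_of_hasProjectiveDimensionLE hRS P n
    ((retractOfIsCompl hPQ).hasProjectiveDimensionLT (n + 1)) fun i hi ↦ ?_
  obtain ⟨c, hc⟩ := exists_maximalIdeal_pow_le_annihilator (hExt i hi)
  exact ⟨c, hc.trans (annihilator_ext_le_of_retract (retractOfIsCompl hPQ) _ i)⟩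

theorem IsExtendedModule.isAlgebraicModule {R : Type u} [CommRing R] [IsLocalRing R]
    [IsNoetherianRing R] {M : Type*} [AddCommGroup M] [Module (LocalCompletion R) M]
    (hM : IsExtendedModule R (LocalCompletion R) M) : IsAlgebraicModule R M := by
  obtain ⟨N, _, _, _, ⟨e⟩⟩ := hM
  exact ⟨N, inferInstance, inferInstance, inferInstance,
    ⟨(AdicCompletion.ofTensorProductEquivOfFiniteNoetherian (maximalIdeal R) N).symm ≪≫ₗ e⟩⟩

theorem theorem3p7 (R : Type u) [CommRing R] [IsLocalRing R] [IsNoetherianRing R]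
    (M : Type u) [AddCommGroup M] [Module (LocalCompletion R) M]
    [Module.Finite (LocalCompletion R) M]
    (hpd : HasFiniteProjectiveDimension (LocalCompletion R) M)
    (hExt : ∀ i : ℕ, 0 < i →
      IsFiniteLength (LocalCompletion R) (ExtIntoRing (LocalCompletion R) M i)) :
    IsStronglyAlgebraicModule R M :=
  fun _ _ hPQ ↦ (theorem3p7_general (isAdicallyDense_maximalIdeal_localCompletion R)
    hpd hExt hPQ).isAlgebraicModule
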